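/- For an edge-coloring of a finite connected simple graph $\Gamma$ (adjacent edges may receive the same color), a strong rainbow path from $u$ to $v$ is a path from $u$ to $v$ of length $d(u,v)$ no two of whose edges have the same color. The strong rainbow connection number $\mathrm{src}(\Gamma)$ is the least $k$ for which $\Gamma$ has an edge-coloring with colors from $\{1,\dots,k\}$ such that any two distinct vertices are joined by a strong rainbow path. For $n\ge 3$ let $C_n$ be the cycle on $n$ vertices, let $C_2$ be the graph consisting of two adjacent vertices, and let $\square$ denote the Cartesian product of graphs. Then, for all integers $n_1,\dots,n_r\ge 2$, $$\mathrm{src}(C_{n_1}\square\cdots\square C_{n_r})\le\left\lceil\frac{n_1+\cdots+n_r}{2}\right\rceil.$$ -/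

import Mathlib

namespace SimpleGraph

/-- A path is rainbow under an edge-coloring `c` if no two of its edges have the same color. -/
def IsRainbow {V K : Type*} {G : SimpleGraph V} (c : G.edgeSet → K) {u v : V}
    (p : G.Walk u v) : Prop :=
  Set.InjOn c {e : G.edgeSet | (e : Sym2 V) ∈ p.edges}

/-- A strong rainbow path from `u` to `v`: a rainbow path of length `d(u, v)`. -/
def IsStrongRainbowPath {V K : Type*} {G : SimpleGraph V} (c : G.edgeSet → K) {u v : V}
    (p : G.Walk u v) : Prop :=
  p.IsPath ∧ IsRainbow c p ∧ p.length = G.dist u v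

/-- `c` is a strong rainbow coloring: any two distinct vertices are joined by a strong rainbow
path. Adjacent edges may have the same color. -/
def IsStrongRainbowColoring {V K : Type*} (G : SimpleGraph V) (c : G.edgeSet → K) : Prop :=
  ∀ u v : V, u ≠ v → ∃ p : G.Walk u v, IsStrongRainbowPath c p

/-- The strong rainbow connection number: the least `k` for which there is a strong rainbow
coloring with `k` available colors. It takes the value `⊤` exactly if no such `k` exists. -/
noncomputable def src {V : Type*} (G : SimpleGraph V) : ℕ∞ :=
  ⨅ (k : ℕ) (_ : ∃ c : G.edgeSet → Fin k, G.IsStrongRainbowColoring c), (k : ℕ∞)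

/-- The Cartesian product of a family of graphs: two vertices are adjacent if they agree in all
coordinates but one, and are adjacent in that coordinate. -/
def boxPi {ι : Type*} {V : ι → Type*} (G : ∀ i, SimpleGraph (V i)) :
    SimpleGraph (∀ i, V i) where
  Adj x y := ∃ i, (G i).Adj (x i) (y i) ∧ ∀ j, j ≠ i → x j = y j
  symm := ⟨fun _ _ ⟨i, h, hj⟩ => ⟨i, h.symm, fun j hji => (hj j hji).symm⟩⟩
  loopless := ⟨fun _ ⟨_, h, _⟩ => h.ne rfl⟩

/-- The product of a family indexed by `Fin (r + 1)` is the binary Cartesian product of the first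
`r` factors, taken together, with the last one. -/
def boxPiSucc {r : ℕ} {V : Fin (r + 1) → Type*} (G : ∀ i, SimpleGraph (V i)) :
    (boxPi fun i : Fin r => G i.castSucc).boxProd (G (Fin.last r)) ≃g boxPi G where
  toFun x := Fin.snoc (α := V) x.1 x.2
  invFun x := (fun i => x i.castSucc, x (Fin.last r))
  left_inv x := by simp
  right_inv x := by
    funext i
    refine Fin.lastCases ?_ (fun j => ?_) i <;> simp
  map_rel_iff' {x y} := by
    simp only [boxPi, boxProd_adj, Equiv.coe_fn_mk]
    constructor
    · rintro ⟨i, h, hj⟩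
      induction i using Fin.lastCases with
      | last =>
        refine Or.inr ⟨by simpa using h, funext fun j => ?_⟩
        simpa using hj j.castSucc (Fin.castSucc_lt_last j).ne
      | cast i =>
        refine Or.inl ⟨⟨i, by simpa using h, fun j hji => ?_⟩, ?_⟩
        · simpa using hj j.castSucc (fun e => hji (Fin.castSucc_injective r e))
        · simpa using hj (Fin.last r) (Fin.castSucc_lt_last i).ne'
    · rintro (⟨⟨i, h, hj⟩, e⟩ | ⟨h, e⟩)
      · refine ⟨i.castSucc, by simpa using h, fun j hji => ?_⟩
        induction j using Fin.lastCases with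
        | last => simpa using e
        | cast j => simpa using hj j (fun e' => hji (by rw [e']))
      · refine ⟨Fin.last r, by simpa using h, fun j hji => ?_⟩
        induction j using Fin.lastCases with
        | last => exact absurd rfl hji
        | cast j => simpa using congrFun e j

end SimpleGraph

/-! Distances add in a Cartesian product, so disjoint palettes on the factors give a strong rainbow
coloring. An even cycle `C_{2a}` needs only `a` colors, but an odd cycle `C_{2a+1}` is given `a +
1`, half a color above its share, so each pair of odd cycles must save one color. The saving comes
from coloring vertices too: an odd cycle has a total coloring with `a + 1` colors in which every
pair is joined by a rainbow geodesic through a vertex `w` whose color is missing from its edges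
(`hasRainbowTotalColoring_cycleGraph_odd`). In `G □ H`, one color of `H` is then dropped, its edges
taking the color of their `G`-vertex; a geodesic that crosses in the direction of `H` above `w`
stays rainbow (`HasRainbowTotalColoring.boxProd_succ`). Factors without a saving preserve the total
coloring, so an induction by parity applies. -/

namespace SimpleGraph

/-! ### Rainbow colorings of Cartesian products -/

section Coloring

variable {V W : Type*} {G : SimpleGraph V} {H : SimpleGraph W}

/-- A walk of minimal length whose edges have distinct colors under `c`. -/
def Walk.IsRainbowGeodesic (c : Sym2 V → ℕ) {u v : V} (p : G.Walk u v) : Prop :=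
  (p.length : ℕ∞) = G.edist u v ∧ (p.edges.map c).Nodup

lemma Walk.IsRainbowGeodesic.reverse {c : Sym2 V → ℕ} {u v : V} {p : G.Walk u v}
    (hp : p.IsRainbowGeodesic c) : p.reverse.IsRainbowGeodesic c := by
  refine ⟨?_, ?_⟩
  · rw [Walk.length_reverse, hp.1, edist_comm]
  · rw [Walk.edges_reverse, List.map_reverse, List.nodup_reverse]
    exact hp.2

/-- `G` has an edge-coloring with `k` colors in which any two vertices are joined by a rainbow
geodesic. -/
def HasRainbowColoring (G : SimpleGraph V) (k : ℕ) : Prop :=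
  ∃ c : Sym2 V → ℕ, (∀ e ∈ G.edgeSet, c e < k) ∧
    ∀ u v, ∃ p : G.Walk u v, p.IsRainbowGeodesic c

/-- `G` has a coloring of its edges and vertices (the vertices being the diagonal of `Sym2 V`) with
`k` colors in which any two vertices are joined by a rainbow geodesic that passes through a vertex
whose color is not on any of its edges. -/
def HasRainbowTotalColoring (G : SimpleGraph V) (k : ℕ) : Prop :=
  ∃ c : Sym2 V → ℕ, (∀ e ∈ G.edgeSet, c e < k) ∧ (∀ v, c s(v, v) < k) ∧
    ∀ u v, ∃ p : G.Walk u v, p.IsRainbowGeodesic c ∧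
      ∃ w ∈ p.support, c s(w, w) ∉ p.edges.map c

lemma HasRainbowTotalColoring.hasRainbowColoring {k : ℕ} (h : G.HasRainbowTotalColoring k) :
    G.HasRainbowColoring k := by
  obtain ⟨c, hc, -, hp⟩ := h
  exact ⟨c, hc, fun u v => (hp u v).imp fun p hp => hp.1⟩

lemma HasRainbowColoring.src_le {k : ℕ} (h : G.HasRainbowColoring k) : G.src ≤ k := by
  obtain ⟨c, hc, hp⟩ := h
  refine iInf₂_le k ⟨fun e => ⟨c e, hc e e.2⟩, fun u v _ => ?_⟩
  obtain ⟨p, hl, hr⟩ := hp u v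
  have hd : p.length = G.dist u v := by rw [dist, ← hl, ENat.toNat_natCast]
  refine ⟨p, p.isPath_of_length_eq_dist hd, fun e he e' he' hee => ?_, hd⟩
  exact Subtype.ext (List.inj_on_of_nodup_map hr he he' (Fin.mk.inj_iff.mp hee))

lemma Iso.edist_eq (φ : G ≃g H) (u v : V) : H.edist (φ u) (φ v) = G.edist u v := by
  refine le_antisymm (le_iInf fun p => by simpa using edist_le (p.map φ.toHom))
    (le_iInf fun p => ?_)
  simpa using edist_le ((p.map φ.symm.toHom).copy (φ.symm_apply_apply u) (φ.symm_apply_apply v))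

lemma Iso.isRainbowGeodesic_map (φ : G ≃g H) {c : Sym2 V → ℕ} {u v : V} {p : G.Walk u v}
    (hp : p.IsRainbowGeodesic c) :
    (p.map φ.toHom).IsRainbowGeodesic (c ∘ Sym2.map φ.symm) := by
  refine ⟨?_, ?_⟩
  · rw [Walk.length_map, hp.1]
    exact (φ.edist_eq u v).symm
  · convert hp.2 using 1
    rw [Walk.edges_map, List.map_map]
    refine List.map_congr_left fun e _ => ?_
    induction e with | _ x y => simp

lemma HasRainbowColoring.iso {k : ℕ} (h : G.HasRainbowColoring k) (φ : G ≃g H) :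
    H.HasRainbowColoring k := by
  obtain ⟨c, hc, hp⟩ := h
  refine ⟨c ∘ Sym2.map φ.symm, fun e he => ?_, fun u v => ?_⟩
  · induction e with | _ x y => exact hc _ (φ.symm.map_adj_iff.mpr he)
  · obtain ⟨p, hp⟩ := hp (φ.symm u) (φ.symm v)
    refine ⟨(p.map φ.toHom).copy (φ.apply_symm_apply u) (φ.apply_symm_apply v), ?_⟩
    have := φ.isRainbowGeodesic_map hp
    refine ⟨?_, ?_⟩
    · simpa using this.1
    · simpa using this.2

lemma HasRainbowTotalColoring.iso {k : ℕ} (h : G.HasRainbowTotalColoring k) (φ : G ≃g H) :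
    H.HasRainbowTotalColoring k := by
  obtain ⟨c, hc, hv, hp⟩ := h
  refine ⟨c ∘ Sym2.map φ.symm, fun e he => ?_, fun v => hv _, fun u v => ?_⟩
  · induction e with | _ x y => exact hc _ (φ.symm.map_adj_iff.mpr he)
  · obtain ⟨p, hp, w, hw, hwp⟩ := hp (φ.symm u) (φ.symm v)
    have := φ.isRainbowGeodesic_map hp
    refine ⟨(p.map φ.toHom).copy (φ.apply_symm_apply u) (φ.apply_symm_apply v),
      ⟨by simpa using this.1, by simpa using this.2⟩, φ w, ?_, ?_⟩
    · simpa using hw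
    · convert hwp using 1
      simp only [Walk.edges_copy, Walk.edges_map, List.map_map, Function.comp_apply, Sym2.map_mk,
        show φ.symm (φ w) = w from φ.symm_apply_apply w]
      congr! 2
      funext e
      induction e with | _ x y => simp

open Classical in
/-- The coloring of `G □ H` that colors the `G`-edges by `c` and the `H`-edges by `d`, shifted by
`k`, except that an `H`-edge of color `l` receives the color of its `G`-vertex. -/
noncomputable def boxColor (c : Sym2 V → ℕ) (d : Sym2 W → ℕ) (k l : ℕ) (e : Sym2 (V × W)) : ℕ :=
  if (e.map Prod.snd).IsDiag ∨ d (e.map Prod.snd) = l then c (e.map Prod.fst)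
  else k + d (e.map Prod.snd)

lemma boxColor_left (c : Sym2 V → ℕ) (d : Sym2 W → ℕ) (k l : ℕ) (x y : V) (b : W) :
    boxColor c d k l s((x, b), (y, b)) = c s(x, y) := by
  simp [boxColor]

lemma boxColor_right (c : Sym2 V → ℕ) (d : Sym2 W → ℕ) (k l : ℕ) (a : V) {x y : W} (h : x ≠ y) :
    boxColor c d k l s((a, x), (a, y)) = if d s(x, y) = l then c s(a, a) else k + d s(x, y) := by
  simp [boxColor, h]

/-- The disjunction serves both uses: `m = l` with `l` colors on `H`, where nothing is replaced, and
`m = l` with `l + 1` colors, where the top one is. -/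
lemma boxColor_lt {c : Sym2 V → ℕ} {d : Sym2 W → ℕ} {k l m : ℕ} (hc : ∀ e ∈ G.edgeSet, c e < k)
    (hd : ∀ e ∈ H.edgeSet, d e ≠ l ∧ d e < m ∨ d e = l ∧ ∀ v, c s(v, v) < k + m) :
    ∀ e ∈ (G □ H).edgeSet, boxColor c d k l e < k + m := by
  intro e he
  induction e with | _ x y =>
  obtain ⟨a, b⟩ := x
  obtain ⟨a', b'⟩ := y
  rw [mem_edgeSet, boxProd_adj] at he
  dsimp only at he
  obtain ⟨h, rfl⟩ | ⟨h, rfl⟩ := he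
  · rw [boxColor_left]
    exact (hc _ h).trans_le (Nat.le_add_right _ _)
  · rw [boxColor_right _ _ _ _ _ h.ne]
    obtain h | h := hd s(b, b') h
    · rw [if_neg h.1]
      exact Nat.add_lt_add_left h.2 k
    · rw [if_pos h.1]
      exact h.2 a

/-- Walks in the factors combine to a walk in the product that moves in the direction of `H` only
above a prescribed vertex `w`. -/
lemma exists_boxProd_walk {a a' w : V} {b b' : W} (p : G.Walk a a') (q : H.Walk b b')
    (hw : w ∈ p.support) :
    ∃ P : (G □ H).Walk (a, b) (a', b'), P.length = p.length + q.length ∧ (w, b) ∈ P.support ∧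
      ∀ (c : Sym2 V → ℕ) (d : Sym2 W → ℕ) (k l : ℕ), (P.edges.map (boxColor c d k l)).Perm
        (p.edges.map c ++ q.edges.map fun e => if d e = l then c s(w, w) else k + d e) := by
  obtain ⟨p₁, p₂, rfl⟩ := Walk.mem_support_iff_exists_append.mp hw
  refine ⟨(p₁.boxProdLeft H b).append ((q.boxProdRight G w).append (p₂.boxProdLeft H b')),
    ?_, ?_, fun c d k l => ?_⟩
  · have left : ∀ {x y : V} (r : G.Walk x y) (z : W), (r.boxProdLeft H z).length = r.length :=
      fun r _ => Walk.length_map _ r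
    have right : (q.boxProdRight G w).length = q.length := Walk.length_map _ q
    simp only [Walk.length_append, left, right]
    omega
  · exact (Walk.mem_support_append_iff _ _).mpr (Or.inl (Walk.end_mem_support _))
  · have left : ∀ {x y : V} (r : G.Walk x y) (z : W),
        (r.boxProdLeft H z).edges.map (boxColor c d k l) = r.edges.map c := by
      intro x y r z
      refine (congrArg _ (Walk.edges_map _ r)).trans ?_
      rw [List.map_map]
      refine List.map_congr_left fun e _ => ?_
      induction e with | _ x y => exact boxColor_left ..
    have right : (q.boxProdRight G w).edges.map (boxColor c d k l) =
        q.edges.map fun e => if d e = l then c s(w, w) else k + d e := by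
      refine (congrArg _ (Walk.edges_map _ q)).trans ?_
      rw [List.map_map]
      refine List.map_congr_left fun e he => ?_
      have := q.edges_subset_edgeSet he
      induction e with | _ x y => exact boxColor_right _ _ _ _ _ (Adj.ne this)
    simp only [Walk.edges_append, List.map_append, left, right, List.append_assoc]
    exact List.Perm.append_left _ List.perm_append_comm

/-- As `q` is rainbow, color `l` occurs on it at most once, so `c s(w, w)` is inserted at most once;
all other colors of `q` are shifted beyond those of `p`. -/
lemma isRainbowGeodesic_boxColor {c : Sym2 V → ℕ} {d : Sym2 W → ℕ} {k l : ℕ} {a a' w : V}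
    {b b' : W} {p : G.Walk a a'} {q : H.Walk b b'} (hc : ∀ e ∈ G.edgeSet, c e < k)
    (hp : p.IsRainbowGeodesic c) (hq : q.IsRainbowGeodesic d)
    (hl : l ∈ q.edges.map d → c s(w, w) < k ∧ c s(w, w) ∉ p.edges.map c)
    {P : (G □ H).Walk (a, b) (a', b')} (hlen : P.length = p.length + q.length)
    (hperm : (P.edges.map (boxColor c d k l)).Perm
      (p.edges.map c ++ q.edges.map fun e => if d e = l then c s(w, w) else k + d e)) :
    P.IsRainbowGeodesic (boxColor c d k l) := by
  refine ⟨?_, ?_⟩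
  · rw [edist_boxProd, hlen, Nat.cast_add, hp.1, hq.1]
  · rw [hperm.nodup_iff, List.nodup_append']
    refine ⟨hp.2, ?_, ?_⟩
    · refine List.Nodup.map_on (fun e he e' he' h => ?_) (List.Nodup.of_map _ hq.2)
      refine List.inj_on_of_nodup_map hq.2 he he' ?_
      have h₁ := fun h : d e = l => (hl (List.mem_map.mpr ⟨e, he, h⟩)).1
      have h₂ := fun h : d e' = l => (hl (List.mem_map.mpr ⟨e', he', h⟩)).1
      split_ifs at h <;> grind
    · intro x hx hx'
      obtain ⟨e, he, rfl⟩ := List.mem_map.mp hx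
      obtain ⟨e', he', h⟩ := List.mem_map.mp hx'
      have hce := hc _ (p.edges_subset_edgeSet he)
      split_ifs at h with hd
      · exact (hl (List.mem_map.mpr ⟨e', he', hd⟩)).2 (h ▸ hx)
      · omega

/-- No edge of `H` has color `l`, so nothing is replaced. The color of `(w, b)` is that of `w`,
which is below `k` and hence also avoids the shifted colors. -/
lemma HasRainbowTotalColoring.boxProd {k l : ℕ} (hG : G.HasRainbowTotalColoring k)
    (hH : H.HasRainbowColoring l) : (G □ H).HasRainbowTotalColoring (k + l) := by
  obtain ⟨c, hc, hv, hp⟩ := hG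
  obtain ⟨d, hd, hq⟩ := hH
  refine ⟨boxColor c d k l, boxColor_lt hc fun e he => Or.inl ⟨(hd e he).ne, hd e he⟩, fun v => ?_, ?_⟩
  · rw [boxColor_left]
    exact (hv _).trans_le (Nat.le_add_right _ _)
  · rintro ⟨a, b⟩ ⟨a', b'⟩
    obtain ⟨p, hp, w, hw, hwp⟩ := hp a a'
    obtain ⟨q, hq⟩ := hq b b'
    obtain ⟨P, hlen, hwP, hperm⟩ := exists_boxProd_walk p q hw
    refine ⟨P, isRainbowGeodesic_boxColor hc hp hq (fun _ => ⟨hv w, hwp⟩) hlen (hperm c d k l),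
      (w, b), hwP, ?_⟩
    rw [boxColor_left, (hperm c d k l).mem_iff, List.mem_append, not_or]
    refine ⟨hwp, fun h => ?_⟩
    obtain ⟨e, he, h⟩ := List.mem_map.mp h
    have := hd e (q.edges_subset_edgeSet he)
    have := hv w
    split_ifs at h <;> omega

lemma HasRainbowTotalColoring.boxProd_succ {k l : ℕ} (hG : G.HasRainbowTotalColoring k)
    (hH : H.HasRainbowColoring (l + 1)) : (G □ H).HasRainbowColoring (k + l) := by
  obtain ⟨c, hc, hv, hp⟩ := hG
  obtain ⟨d, hd, hq⟩ := hH
  refine ⟨boxColor c d k l, boxColor_lt hc fun e he => ?_, ?_⟩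
  · exact (Nat.lt_succ_iff_lt_or_eq.mp (hd e he)).imp (fun h => ⟨h.ne, h⟩) fun h =>
      ⟨h, fun v => (hv v).trans_le (Nat.le_add_right _ _)⟩
  · rintro ⟨a, b⟩ ⟨a', b'⟩
    obtain ⟨p, hp, w, hw, hwp⟩ := hp a a'
    obtain ⟨q, hq⟩ := hq b b'
    obtain ⟨P, hlen, -, hperm⟩ := exists_boxProd_walk p q hw
    exact ⟨P, isRainbowGeodesic_boxColor hc hp hq (fun _ => ⟨hv w, hwp⟩) hlen (hperm c d k l)⟩

lemma HasRainbowColoring.boxProd {k l : ℕ} (hG : G.HasRainbowColoring k)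
    (hH : H.HasRainbowColoring l) : (G □ H).HasRainbowColoring (k + l) := by
  obtain ⟨c, hc, hp⟩ := hG
  obtain ⟨d, hd, hq⟩ := hH
  refine ⟨boxColor c d k l, boxColor_lt hc fun e he => Or.inl ⟨(hd e he).ne, hd e he⟩, ?_⟩
  rintro ⟨a, b⟩ ⟨a', b'⟩
  obtain ⟨p, hp⟩ := hp a a'
  obtain ⟨q, hq⟩ := hq b b'
  obtain ⟨P, hlen, -, hperm⟩ := exists_boxProd_walk p q p.start_mem_support
  refine ⟨P, isRainbowGeodesic_boxColor hc hp hq (fun h => ?_) hlen (hperm c d k l)⟩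
  obtain ⟨e, he, h⟩ := List.mem_map.mp h
  exact absurd (hd e (q.edges_subset_edgeSet he)) (by omega)

lemma HasRainbowColoring.boxProd_total {k l : ℕ} (hG : G.HasRainbowColoring k)
    (hH : H.HasRainbowTotalColoring l) : (G □ H).HasRainbowTotalColoring (k + l) := by
  rw [add_comm]
  exact (hH.boxProd hG).iso (boxProdComm H G)

end Coloring

/-! ### Colorings of a single cycle -/

section Cycle

/-- The coloring of `cycleGraph n` that gives the vertex `x` the color `h x` and the edge from `x`
to `x + 1` the color `g x`. -/
def cycleColor (n : ℕ) (g h : ℕ → ℕ) (e : Sym2 (Fin n)) : ℕ :=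
  if (e.sup : ℕ) = e.inf then h e.inf else
    if (e.sup : ℕ) = e.inf + 1 then g e.inf else g (n - 1)

lemma cycleColor_diag {n : ℕ} (g h : ℕ → ℕ) (v : Fin n) : cycleColor n g h s(v, v) = h v := by
  simp [cycleColor]

lemma cycleColor_lt {n k : ℕ} (hn : 0 < n) {g h : ℕ → ℕ} (hg : ∀ x < n, g x < k)
    (hh : ∀ x < n, h x < k) (e : Sym2 (Fin n)) : cycleColor n g h e < k := by
  unfold cycleColor
  split_ifs
  · exact hh _ e.inf.isLt
  · exact hg _ e.inf.isLt
  · exact hg _ (by omega)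

/-- The residue of `x` as a vertex of `cycleGraph n`. -/
def cycleVertex (n : ℕ) [NeZero n] (x : ℕ) : Fin n := Fin.ofNat n x

@[simp]
lemma val_cycleVertex (n : ℕ) [NeZero n] (x : ℕ) : (cycleVertex n x : ℕ) = x % n := rfl

lemma mod_succ_eq {n : ℕ} (hn : 2 ≤ n) (x : ℕ) :
    (x + 1) % n = if x % n + 1 = n then 0 else x % n + 1 := by
  have := Nat.mod_lt x (show 0 < n by omega)
  rw [Nat.add_mod, Nat.mod_eq_of_lt (show 1 < n by omega)]
  split_ifs with h
  · rw [h, Nat.mod_self]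
  · exact Nat.mod_eq_of_lt (by omega)

lemma cycleVertex_adj {n : ℕ} [NeZero n] (hn : 2 ≤ n) (x : ℕ) :
    (cycleGraph n).Adj (cycleVertex n x) (cycleVertex n (x + 1)) := by
  rw [cycleGraph_adj']
  right
  have := Nat.mod_lt x (show 0 < n by omega)
  rw [Fin.sub_def, val_cycleVertex, val_cycleVertex, mod_succ_eq hn]
  dsimp only
  split_ifs with h
  · rw [show n - x % n + 0 = 1 by omega, Nat.mod_eq_of_lt (by omega)]
  · rw [show n - x % n + (x % n + 1) = 1 + n by omega, Nat.add_mod_right,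
      Nat.mod_eq_of_lt (by omega)]

/-- For `n = 2` the steps from 0 and from 1 use the same edge, so `g` must agree on them. -/
lemma cycleColor_edge {n : ℕ} [NeZero n] (hn : 2 ≤ n) {g : ℕ → ℕ} (hg : n = 2 → g 0 = g 1)
    (h : ℕ → ℕ) (x : ℕ) :
    cycleColor n g h s(cycleVertex n x, cycleVertex n (x + 1)) = g (x % n) := by
  have := Nat.mod_lt x (show 0 < n by omega)
  have hi : ∀ u v : Fin n, ((u ⊓ v : Fin n) : ℕ) = min (u : ℕ) v := fun u v =>
    Fin.val_strictMono.monotone.map_min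
  have hs : ∀ u v : Fin n, ((u ⊔ v : Fin n) : ℕ) = max (u : ℕ) v := fun u v =>
    Fin.val_strictMono.monotone.map_max
  simp only [cycleColor, Sym2.sup_mk, Sym2.inf_mk, hi, hs, val_cycleVertex, mod_succ_eq hn]
  by_cases hx : x % n + 1 = n
  · simp only [hx, if_true, Nat.zero_le, sup_of_le_left, inf_of_le_right]
    rw [if_neg (by omega)]
    split_ifs with h1
    · rw [show x % n = 1 by omega, hg (by omega)]
    · congr 1; omega
  · simp [hx]

/-- The walk that makes `k` steps forward from the residue of `u`. -/
lemma exists_cycleGraph_walk {n : ℕ} [NeZero n] (hn : 2 ≤ n) {g : ℕ → ℕ}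
    (hg : n = 2 → g 0 = g 1) (h : ℕ → ℕ) (u k : ℕ) :
    ∃ p : (cycleGraph n).Walk (cycleVertex n u) (cycleVertex n (u + k)), p.length = k ∧
      p.edges.map (cycleColor n g h) = (List.range k).map (fun i => g ((u + i) % n)) ∧
      ∀ i ≤ k, cycleVertex n (u + i) ∈ p.support := by
  induction k with
  | zero => exact ⟨Walk.nil, rfl, rfl, fun i hi => by simp [Nat.le_zero.mp hi]⟩
  | succ k ih =>
    obtain ⟨p, hl, hc, hs⟩ := ih
    refine ⟨p.concat (cycleVertex_adj hn (u + k)), by simp [hl], ?_, fun i hi => ?_⟩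
    · rw [Walk.edges_concat, List.concat_eq_append, List.map_append, hc, List.range_succ,
        List.map_append, List.map_singleton, List.map_singleton, ← add_assoc, cycleColor_edge hn hg]
    · rw [Walk.support_concat, List.mem_append, List.mem_singleton]
      obtain hi | rfl := Nat.le_succ_iff.mp hi
      · exact Or.inl (hs i hi)
      · exact Or.inr rfl

/-- Here `z` is the number of forward steps minus the number of backward steps. -/
lemma exists_dvd_of_cycleGraph_walk {n : ℕ} {u v : Fin n} (p : (cycleGraph n).Walk u v) :
    ∃ z : ℤ, |z| ≤ p.length ∧ (n : ℤ) ∣ v - u - z := by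
  induction p with
  | nil => exact ⟨0, by simp⟩
  | @cons u v w h p ih =>
    obtain ⟨z, hz, hd⟩ := ih
    have key : ∀ {u v : Fin n}, ((u - v : Fin n) : ℕ) = 1 → (n : ℤ) ∣ u - v - 1 := by
      intro u v h
      rw [Fin.sub_def] at h
      dsimp only at h
      have h' : ((n : ℤ) - v + u) % n = 1 := by
        have := congrArg (Nat.cast : ℕ → ℤ) h
        rwa [Int.natCast_emod, Nat.cast_add, Nat.cast_sub v.isLt.le, Nat.cast_one] at this
      have := Int.dvd_self_sub_of_emod_eq h'
      rw [show (u : ℤ) - v - 1 = (n - v + u) - 1 - n by ring]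
      exact this.sub (dvd_refl _)
    rw [Walk.length_cons, Nat.cast_add, Nat.cast_one]
    obtain h | h := cycleGraph_adj'.mp h
    · refine ⟨z - 1, ?_, ?_⟩
      · have := abs_sub z 1
        simp only [abs_one] at this
        omega
      · rw [show (w : ℤ) - u - (z - 1) = w - v - z - (u - v - 1) by ring]
        exact hd.sub (key h)
    · refine ⟨z + 1, ?_, ?_⟩
      · have := abs_add_le z 1
        simp only [abs_one] at this
        omega
      · rw [show (w : ℤ) - u - (z + 1) = w - v - z + (v - u - 1) by ring]
        exact hd.add (key h)

lemma edist_cycleGraph {n : ℕ} [NeZero n] (hn : 2 ≤ n) (u : ℕ) {k : ℕ} (hk : 2 * k ≤ n) :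
    (cycleGraph n).edist (cycleVertex n u) (cycleVertex n (u + k)) = k := by
  refine le_antisymm ?_ (le_iInf fun p => ?_)
  · obtain ⟨p, hl, -⟩ := exists_cycleGraph_walk hn (g := 0) (fun _ => rfl) 0 u k
    exact (edist_le p).trans_eq (congrArg _ hl)
  · obtain ⟨z, hz, hd⟩ := exists_dvd_of_cycleGraph_walk p
    rw [Nat.cast_le]
    have hd' : (n : ℤ) ∣ (k : ℤ) - z := by
      have h₁ := Int.dvd_self_sub_emod (m := n) (x := ((u + k : ℕ) : ℤ))
      have h₂ := Int.dvd_self_sub_emod (m := n) (x := (u : ℤ))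
      simp only [val_cycleVertex, Int.natCast_emod] at hd
      rw [show (k : ℤ) - z = (((u + k : ℕ) : ℤ) % n - (u : ℤ) % n - z +
        (((u + k : ℕ) : ℤ) - ((u + k : ℕ) : ℤ) % n)) - (u - (u : ℤ) % n) by push_cast; ring]
      exact (hd.add h₁).sub h₂
    -- A shorter walk has `|z| < k`, so `0 < k - z < 2 * k ≤ n`, against divisibility by `n`.
    by_contra! hlt
    obtain ⟨h₁, h₂⟩ := abs_le.mp hz
    have := Int.le_of_dvd (by omega) hd'
    omega

/-- Any two vertices of a cycle are joined, in one direction or the other, by a walk of at most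
`n / 2` steps forward. -/
lemma cycleGraph_induction {n : ℕ} [NeZero n] {P : Fin n → Fin n → Prop}
    (symm : ∀ u v, P u v → P v u)
    (forward : ∀ u k, u < n → 2 * k ≤ n → P (cycleVertex n u) (cycleVertex n (u + k)))
    (u v : Fin n) : P u v := by
  have key : ∀ u v : Fin n, u ≤ v → P u v := by
    intro u v huv
    have hu : cycleVertex n u = u := Fin.ext (Nat.mod_eq_of_lt u.isLt)
    have hv : cycleVertex n v = v := Fin.ext (Nat.mod_eq_of_lt v.isLt)
    have huv : (u : ℕ) ≤ v := huv
    by_cases h : 2 * (v - u : ℕ) ≤ n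
    · have := forward u (v - u) u.isLt h
      rwa [Nat.add_sub_cancel' huv, hu, hv] at this
    · have := forward v (n - (v - u)) v.isLt (by omega)
      rw [show (v : ℕ) + (n - (v - u)) = u + n by omega, hv] at this
      have hun : cycleVertex n (u + n) = u := by
        rw [← hu]
        exact Fin.ext (by simp)
      exact symm _ _ (hun ▸ this)
  obtain h | h := le_total u v
  · exact key u v h
  · exact symm _ _ (key v u h)

lemma nodup_map_range {f : ℕ → ℕ} {k : ℕ} (h : ∀ i j, i < j → j < k → f i ≠ f j) :
    ((List.range k).map f).Nodup := by
  refine List.Nodup.map_on (fun i hi j hj hij => ?_) List.nodup_range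
  rw [List.mem_range] at hi hj
  by_contra hne
  obtain hlt | hlt := Nat.lt_or_gt_of_ne hne
  · exact h i j hlt hj hij
  · exact h j i hlt hi hij.symm

/-- Opposite edges share a color, and a geodesic has at most `a` consecutive edges, whose indices
are distinct modulo `a`. -/
lemma hasRainbowColoring_cycleGraph_even {a : ℕ} (ha : 1 ≤ a) :
    (cycleGraph (2 * a)).HasRainbowColoring a := by
  have : NeZero (2 * a) := ⟨by omega⟩
  have hlt : ∀ x < 2 * a, x % a < a := fun x _ => Nat.mod_lt x ha
  refine ⟨cycleColor (2 * a) (· % a) (· % a),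
    fun e _ => cycleColor_lt (by omega) hlt hlt e, ?_⟩
  refine cycleGraph_induction (fun u v ⟨p, hp⟩ => ⟨p.reverse, hp.reverse⟩) fun u k hu hk => ?_
  obtain ⟨p, hl, hc, -⟩ := exists_cycleGraph_walk (n := 2 * a) (by omega) (g := (· % a))
    (fun h => by simp [show a = 1 by omega]) (· % a) u k
  refine ⟨p, by rw [edist_cycleGraph (by omega) u hk, hl], ?_⟩
  rw [hc]
  refine nodup_map_range fun i j hij hj h => ?_
  simp only [Nat.mod_mul_left_mod] at h
  have := (Nat.modEq_iff_dvd' (show u + i ≤ u + j by omega)).mp h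
  have := Nat.le_of_dvd (by omega) this
  omega

/-- Around the cycle the edges are colored `0, …, a - 1, 0, …, a` and the vertices `0, …, a, 0, …, a
- 1`. Equal edge colors are at least `a` steps apart, so at most `a` consecutive edges form a
rainbow. -/
lemma hasRainbowTotalColoring_cycleGraph_odd {a : ℕ} (ha : 1 ≤ a) :
    (cycleGraph (2 * a + 1)).HasRainbowTotalColoring (a + 1) := by
  let g : ℕ → ℕ := fun x => if x < a then x else x - a
  let h : ℕ → ℕ := fun x => if x ≤ a then x else x - (a + 1)
  have hg : ∀ x < 2 * a + 1, g x < a + 1 := fun x hx => by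
    dsimp only [g, h]
    split_ifs <;> omega
  have hh : ∀ x < 2 * a + 1, h x < a + 1 := fun x hx => by
    dsimp only [g, h]
    split_ifs <;> omega
  refine ⟨cycleColor (2 * a + 1) g h, fun e _ => cycleColor_lt (by omega) hg hh e,
    fun v => cycleColor_lt (by omega) hg hh _, ?_⟩
  refine cycleGraph_induction (fun u v ⟨p, hp, w, hw, hwp⟩ => ⟨p.reverse, hp.reverse, w, ?_, ?_⟩)
    fun u k hu hk => ?_
  · simpa using hw
  · simpa [-List.mem_map] using hwp
  have hmod : ∀ i ≤ k, (u + i) % (2 * a + 1) =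
      if u + i < 2 * a + 1 then u + i else u + i - (2 * a + 1) := fun i hi => by
    split_ifs with hlt
    · exact Nat.mod_eq_of_lt hlt
    · rw [Nat.mod_eq_sub_mod (by omega), Nat.mod_eq_of_lt (by omega)]
  obtain ⟨p, hl, hc, hs⟩ := exists_cycleGraph_walk (n := 2 * a + 1) (by omega) (g := g)
    (fun h => by omega) h u k
  -- The free vertex is the last one if the walk reaches 0 by wrapping around or ends before `a`,
  -- the vertex `a` if the walk meets it (only the edge from `2 * a` to 0 has color `a`), and
  -- otherwise the first one.
  have hfree : ∃ i ≤ k, ∀ j < k, h ((u + i) % (2 * a + 1)) ≠ g ((u + j) % (2 * a + 1)) := by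
    by_cases h₁ : 2 * a + 1 ≤ u + k
    · refine ⟨k, le_rfl, fun j hj => ?_⟩
      rw [hmod k le_rfl, hmod j hj.le]
      simp only [g, h]
      split_ifs <;> omega
    by_cases h₂ : u + k < a
    · refine ⟨k, le_rfl, fun j hj => ?_⟩
      rw [hmod k le_rfl, hmod j hj.le]
      simp only [g, h]
      split_ifs <;> omega
    by_cases h₃ : u ≤ a
    · refine ⟨a - u, by omega, fun j hj => ?_⟩
      rw [hmod _ (by omega), hmod j hj.le]
      simp only [g, h]
      split_ifs <;> omega
    · refine ⟨0, by omega, fun j hj => ?_⟩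
      rw [hmod _ (by omega), hmod j hj.le]
      simp only [g, h]
      split_ifs <;> omega
  obtain ⟨i, hi, hfree⟩ := hfree
  refine ⟨p, ⟨by rw [edist_cycleGraph (by omega) u (by omega), hl], ?_⟩, _, hs i hi, ?_⟩
  · rw [hc]
    refine nodup_map_range fun i j hij hj => ?_
    rw [hmod i (by omega), hmod j hj.le]
    simp only [g]
    split_ifs <;> omega
  · rw [cycleColor_diag, hc, List.mem_map]
    rintro ⟨j, hj, h⟩
    exact hfree j (List.mem_range.mp hj) h.symm

end Cycle

/-! ### Induction on the number of factors -/

/-- For an odd sum the total coloring is carried along because the next odd cycle consumes it to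
save a color. -/
lemma hasRainbowColoring_boxPi_cycleGraph (r : ℕ) (n : Fin r → ℕ) (hn : ∀ k, 2 ≤ n k) :
    (∀ m, ∑ k, n k = 2 * m → (boxPi fun k => cycleGraph (n k)).HasRainbowColoring m) ∧
    ∀ m, ∑ k, n k = 2 * m + 1 →
      (boxPi fun k => cycleGraph (n k)).HasRainbowTotalColoring (m + 1) := by
  induction r with
  | zero =>
    refine ⟨fun m _ => ⟨0, fun e he => ?_, fun u v => ?_⟩, fun m hm => ?_⟩
    · induction e with | _ x y => exact absurd (Subsingleton.elim x y) (mem_edgeSet _ |>.mp he).ne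
    · obtain rfl := Subsingleton.elim u v
      exact ⟨Walk.nil, by simp [Walk.IsRainbowGeodesic]⟩
    · simp at hm
  | succ r ih =>
    have φ := boxPiSucc fun k => cycleGraph (n k)
    have hl := hn (Fin.last r)
    obtain ⟨even, odd⟩ := ih (fun k => n k.castSucc) fun k => hn _
    rw [Fin.sum_univ_castSucc]
    obtain ⟨a, ha⟩ | ⟨a, ha⟩ := Nat.even_or_odd (n (Fin.last r)) <;>
    obtain ⟨s, hs⟩ | ⟨s, hs⟩ := Nat.even_or_odd (∑ k : Fin r, n k.castSucc)
    · have hC := hasRainbowColoring_cycleGraph_even (a := a) (by omega)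
      rw [show 2 * a = n (Fin.last r) by omega] at hC
      refine ⟨fun m hm => ?_, fun m hm => by omega⟩
      rw [show m = s + a by omega]
      exact ((even s (by omega)).boxProd hC).iso φ
    · have hC := hasRainbowColoring_cycleGraph_even (a := a) (by omega)
      rw [show 2 * a = n (Fin.last r) by omega] at hC
      refine ⟨fun m hm => by omega, fun m hm => ?_⟩
      rw [show m + 1 = s + 1 + a by omega]
      exact ((odd s hs).boxProd hC).iso φ
    · have hC := hasRainbowTotalColoring_cycleGraph_odd (a := a) (by omega)
      rw [← ha] at hC
      refine ⟨fun m hm => by omega, fun m hm => ?_⟩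
      rw [show m + 1 = s + (a + 1) by omega]
      exact ((even s (by omega)).boxProd_total hC).iso φ
    · have hC := hasRainbowTotalColoring_cycleGraph_odd (a := a) (by omega)
      rw [← ha] at hC
      refine ⟨fun m hm => ?_, fun m hm => by omega⟩
      -- The cycle's `a + 1` colors contribute only `a`.
      rw [show m = s + 1 + a by omega]
      exact ((odd s hs).boxProd_succ hC.hasRainbowColoring).iso φ

end SimpleGraph

theorem propositions7 (r : ℕ) (n : Fin r → ℕ) (hn : ∀ k, 2 ≤ n k) :
    SimpleGraph.src (SimpleGraph.boxPi fun k : Fin r => SimpleGraph.cycleGraph (n k)) ≤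
      ((⌈((∑ k : Fin r, (n k : ℚ)) / 2)⌉₊ : ℕ) : ℕ∞) := by
  obtain ⟨even, odd⟩ := SimpleGraph.hasRainbowColoring_boxPi_cycleGraph r n hn
  rw [← Nat.cast_sum]
  obtain ⟨m, hm⟩ | ⟨m, hm⟩ := Nat.even_or_odd (∑ k, n k)
  · refine (even m (by omega)).src_le.trans (Nat.cast_le.mpr ?_)
    rw [hm, ← Nat.cast_le (α := ℚ)]
    refine le_trans (le_of_eq ?_) (Nat.le_ceil _)
    push_cast
    ring
  · refine (odd m hm).hasRainbowColoring.src_le.trans (Nat.cast_le.mpr ?_)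
    rw [hm, Nat.succ_le_iff, Nat.lt_ceil]
    push_cast
    linarith
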